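/- Let $n \ge 0$ and $d \ge 1$ be integers. Consider $n$ agents with positions in $\mathbb{R}^d$ that start from an arbitrary initial configuration $x(0)$ and operate in rounds $t = 1, 2, \dots$. In round $t$ the communication is given by an arbitrary directed graph $G_t$ on the agents with a self-loop at each node; agent $p$ receives the positions $x_q(t-1)$ of its in-neighbors $q \in \mathrm{In}_p(t)$ in $G_t$ and computes its new position $x_p(t)$ from these messages. For a nonempty bounded convex polytope $A \subseteq \mathbb{R}^d$ (the convex hull of a nonempty finite set of points), let $\mathrm{centroid}(A)$ be its centroid with respect to the uniform mass distribution on $A$, that is, with respect to $k$-dimensional volume on the affine span of $A$, where $k$ is the dimension of that span. In the Centroid algorithm, each agent moves to the centroid of the convex hull of its in-neighbors' positions: $$x_p(t) = \mathrm{centroid}\big(\mathrm{conv}\{x_q(t-1) : q \in \mathrm{In}_p(t)\}\big).$$ Then the Centroid algorithm is a $\frac{1}{d+1}$-safe convex combination algorithm. Explicitly, for every initial configuration, every sequence of communication graphs, every agent $p$ and every $t \ge 0$: (a) (convex combination) $x_p(t+1) = \sum_{q \in \mathrm{In}_p(t+1)} w_{pq}(t+1)\, x_q(t)$ for some weights $w_{pq}(t+1)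 \ge 0$ with $\sum_{q \in \mathrm{In}_p(t+1)} w_{pq}(t+1) = 1$ that are functions of the messages received by $p$ in round $t+1$; (b) ($\alpha$-safeness) with $\alpha = \frac{1}{d+1} \in [0, \frac12]$, for every $i \in \{1, \dots, d\}$, $$\alpha M_{p,i}(t) + (1-\alpha)\, m_{p,i}(t) \le x_{p,i}(t+1) \le (1-\alpha) M_{p,i}(t) + \alpha\, m_{p,i}(t),$$ where $m_{p,i}(t)$ and $M_{p,i}(t)$ are the minimum and the maximum of $x_{q,i}(t)$ over $q \in \mathrm{In}_p(t+1)$. Moreover, for every nonempty bounded convex polytope $A \subseteq \mathbb{R}^d$, we have $\mathrm{centroid}(A) \in A$, and for every $j \in \{1, \dots, d\}$, with $m_j(A) = \inf_{x \in A} x_j$ and $M_j(A) = \sup_{x \in A} x_j$, $$\frac{1}{d+1} M_j(A) + \frac{d}{d+1} m_j(A) \le \mathrm{centroid}_j(A) \le \frac{1}{d+1} m_j(A) + \frac{d}{d+1} M_j(A).$$ -/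

import Mathlib

open MeasureTheory

/-- Positions of agents: Euclidean `d`-space. -/
abbrev Position (d : ℕ) : Type := EuclideanSpace ℝ (Fin d)

/-- A communication graph on the agents `Fin n`: a directed graph with a self-loop at each node.
`Adj q p` is the edge from `q` to `p`. -/
structure CommGraph (n : ℕ) extends Digraph (Fin n) where
  self_loop : ∀ p : Fin n, Adj p p

open Classical in
/-- The set of in-neighbors of agent `p`. -/
noncomputable def CommGraph.inNeighbors {n : ℕ} (G : CommGraph n) (p : Fin n) : Finset (Fin n) :=
  Finset.univ.filter fun q => G.Adj q p

theorem CommGraph.inNeighbors_nonempty {n : ℕ} (G : CommGraph n) (p : Fin n) :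
    (G.inNeighbors p).Nonempty :=
  ⟨p, by simp [CommGraph.inNeighbors, G.self_loop p]⟩

/-- A deterministic local algorithm whose state is the position of the agent: the transition
function of agent `p` maps the collection of incoming messages (the set `S` of the agents from
which `p` hears, together with their positions) to the new position of `p`. -/
structure Algorithm (n d : ℕ) where
  step : (p : Fin n) → (S : Finset (Fin n)) → (S → Position d) → Position d

/-- The execution from the initial configuration `x₀` with the communication pattern `G`:
`A.run G x₀ t p` is the position of `p` at the end of round `t`, and `G t` is the communication
graph of round `t` for `t ≥ 1` (the value `G 0` is not used). -/
noncomputable def Algorithm.run {n d : ℕ} (A : Algorithm n d) (G : ℕ → CommGraph n) (x₀ : Fin n → Position d) :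
    ℕ → Fin n → Position d
  | 0 => x₀
  | t + 1 => fun p => A.step p ((G (t + 1)).inNeighbors p) fun q => A.run G x₀ t q

/-- Convex combination algorithm: in every round of every execution, every agent moves to a convex
combination of the positions that it has just received, with weights that are locally computable,
that is, functions of the messages received by the agent. -/
def Algorithm.IsConvexCombination {n d : ℕ} (A : Algorithm n d) : Prop :=
  ∃ w : (p : Fin n) → (S : Finset (Fin n)) → (S → Position d) → S → ℝ,
    ∀ (G : ℕ → CommGraph n) (x₀ : Fin n → Position d) (t : ℕ) (p : Fin n),
      let S := (G (t + 1)).inNeighbors p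
      let y : S → Position d := fun q => A.run G x₀ t q
      (∀ q : S, 0 ≤ w p S y q) ∧ ∑ q : S, w p S y q = 1 ∧
        A.run G x₀ (t + 1) p = ∑ q : S, w p S y q • y q

/-- The minimum of the `i`-th components of the positions `x q` over the in-neighbors `q`
of `p`. -/
noncomputable def CommGraph.minCoord {n d : ℕ} (G : CommGraph n) (x : Fin n → Position d)
    (p : Fin n) (i : Fin d) : ℝ :=
  (G.inNeighbors p).inf' (G.inNeighbors_nonempty p) fun q => x q i

/-- The maximum of the `i`-th components of the positions `x q` over the in-neighbors `q`
of `p`. -/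
noncomputable def CommGraph.maxCoord {n d : ℕ} (G : CommGraph n) (x : Fin n → Position d)
    (p : Fin n) (i : Fin d) : ℝ :=
  (G.inNeighbors p).sup' (G.inNeighbors_nonempty p) fun q => x q i

/-- `α`-safeness, for `α ∈ [0, 1/2]`: in every round of every execution, along each dimension, each
agent adopts a value that is not too close to the boundary of the interval spanned by the values of
its in-neighbors. -/
def Algorithm.IsSafe {n d : ℕ} (A : Algorithm n d) (α : ℝ) : Prop :=
  α ∈ Set.Icc (0 : ℝ) (1 / 2) ∧
    ∀ (G : ℕ → CommGraph n) (x₀ : Fin n → Position d) (t : ℕ) (p : Fin n) (i : Fin d),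
      let m := (G (t + 1)).minCoord (A.run G x₀ t) p i
      let M := (G (t + 1)).maxCoord (A.run G x₀ t) p i
      α * M + (1 - α) * m ≤ A.run G x₀ (t + 1) p i ∧
        A.run G x₀ (t + 1) p i ≤ (1 - α) * M + α * m

/-- The centroid of `A` with uniform mass distribution on `A`. If the affine span of `A` has
dimension `k`, mass is `k`-dimensional volume, here the `k`-dimensional Hausdorff measure, whose
normalization cancels in the average. For `k = d` this is the usual centroid with respect to
Lebesgue measure, and for a point it is the point. -/
noncomputable def centroid {d : ℕ} (A : Set (Position d)) : Position d :=
  ⨍ x in A, x ∂(Measure.hausdorffMeasure (Module.finrank ℝ (vectorSpan ℝ A) : ℝ))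

/-- The Centroid algorithm: each agent moves to the centroid of the convex hull of the positions of
its in-neighbors. -/
noncomputable def centroidAlgorithm (n d : ℕ) : Algorithm n d where
  step _ _ y := centroid (convexHull ℝ (Set.range y))

/-- Nonempty bounded convex polytopes: convex hulls of nonempty finite sets of points. -/
def IsPolytope {d : ℕ} (A : Set (Position d)) : Prop :=
  ∃ F : Finset (Position d), F.Nonempty ∧ A = convexHull ℝ (F : Set (Position d))

/-- `m_j(A)`, the infimum of the `j`-th coordinate on `A`. -/
noncomputable def infCoord {d : ℕ} (A : Set (Position d)) (j : Fin d) : ℝ :=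
  sInf ((fun x : Position d => x j) '' A)

/-- `M_j(A)`, the supremum of the `j`-th coordinate on `A`. -/
noncomputable def supCoord {d : ℕ} (A : Set (Position d)) (j : Fin d) : ℝ :=
  sSup ((fun x : Position d => x j) '' A)

/-!
Let `A` be a compact convex set whose span has dimension `k`, and let `μ` be the `k`-dimensional
Hausdorff measure. Transported to the span by an isometry, `μ` is a Haar measure there and `A` has
nonempty interior, so `0 < μ A < ∞` (`hausdorffMeasure_pos_and_lt_top`); in particular the centroid
is an average over a closed convex set and lies in it, which yields the convex combination property.

For the coordinate bounds, let `f` be linear with `m ≤ f` on `A`, let `a ∈ A`, and write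
`g = f a - f` and `L = f a - m`, so that `g ≤ L` on `A`. For `0 < s < 1` let `sA ⊆ A` be the image of
`A` under the homothety of ratio `s` centred at `a`. Then `μ (sA) = s ^ k * μ A`, and
`∫ g` over `sA` is `s ^ (k + 1) * ∫ g` over `A`. Bounding `g` by `L` on `A \ sA` gives
`(1 - s ^ (k + 1)) * ∫ g ≤ (1 - s ^ k) * L * μ A`. Dividing by `1 - s` and letting `s → 1`,
`(k + 1) * ∫ g ≤ k * L * μ A`, that is, the average of `f` is at least `(f a + k * m) / (k + 1)`
(`StarConvex.integral_apex_sub_le`, `le_setAverage`). The upper bound is the same fact for `-f`, and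
`k ≤ d`. Only star-shapedness at `a` is used here; no slicing of `A` is needed.
-/

/-! ### Hausdorff measure of compact convex sets -/

open Module Filter Topology Set in
/-- A nonempty compact convex set has positive and finite Hausdorff measure in the dimension of its
span. -/
theorem hausdorffMeasure_pos_and_lt_top {E : Type*} [NormedAddCommGroup E] [NormedSpace ℝ E]
    [FiniteDimensional ℝ E] [MeasurableSpace E] [BorelSpace E] {A : Set E}
    (hconv : Convex ℝ A) (hcomp : IsCompact A) (hne : A.Nonempty) :
    0 < Measure.hausdorffMeasure (finrank ℝ (vectorSpan ℝ A) : ℝ) A ∧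
      Measure.hausdorffMeasure (finrank ℝ (vectorSpan ℝ A) : ℝ) A < ⊤ := by
  obtain ⟨a, ha⟩ := hne
  have hadd : ∀ v : vectorSpan ℝ A, (v : E) + a ∈ affineSpan ℝ A := fun v =>
    AffineSubspace.vadd_mem_of_mem_direction (by rw [direction_affineSpan]; exact v.2)
      (subset_affineSpan ℝ A ha)
  set j : vectorSpan ℝ A → E := fun v => v + a with hj
  have hiso : Isometry j := Isometry.of_dist_eq fun v w => by
    simp only [hj, dist_add_right, Subtype.dist_eq]
  have himage : j '' (j ⁻¹' A) = A := by
    refine image_preimage_eq_of_subset fun x hx => ⟨⟨x - a, ?_⟩, by simp [hj]⟩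
    exact vsub_mem_vectorSpan ℝ hx ha
  have hcompact : IsCompact (j ⁻¹' A) := hiso.isClosedEmbedding.isCompact_preimage hcomp
  -- The intrinsic interior of `A` is an interior in the affine span; pull it back to the direction.
  have hint : (interior (j ⁻¹' A)).Nonempty := by
    obtain ⟨x, hx⟩ := Set.Nonempty.intrinsicInterior hconv ⟨a, ha⟩
    obtain ⟨y, hy, rfl⟩ := mem_intrinsicInterior.1 hx
    have hcont : Continuous fun v : vectorSpan ℝ A => (⟨v + a, hadd v⟩ : affineSpan ℝ A) :=
      (continuous_subtype_val.add continuous_const).subtype_mk _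
    refine ⟨⟨y - a, ?_⟩,
      preimage_interior_subset_interior_preimage (t := (↑) ⁻¹' A) hcont ?_⟩
    · rw [← direction_affineSpan]
      exact AffineSubspace.vsub_mem_direction y.2 (subset_affineSpan ℝ A ha)
    · simpa using hy
  rw [← himage, hiso.hausdorffMeasure_image (Or.inl (Nat.cast_nonneg _)), himage]
  exact ⟨Measure.measure_pos_of_nonempty_interior _ hint, hcompact.measure_lt_top⟩

/-! ### Averages of linear functions on star-shaped sets -/

/-- The integral over a homothetic copy of a set of a linear function vanishing at the centre. -/
theorem setIntegral_homothety_image {E : Type*} [NormedAddCommGroup E] [NormedSpace ℝ E]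
    [MeasurableSpace E] [BorelSpace E] (k : ℕ) (f : E →L[ℝ] ℝ) (a : E) {s : ℝ} (hs : 0 < s)
    (A : Set E) (hA : MeasurableSet (AffineMap.homothety a s '' A)) :
    ∫ x in AffineMap.homothety a s '' A, (f a - f x) ∂(Measure.hausdorffMeasure (k : ℝ)) =
      s ^ (k + 1) * ∫ x in A, (f a - f x) ∂(Measure.hausdorffMeasure (k : ℝ)) := by
  have hmap := map_homothety_hausdorffMeasure (𝕜 := ℝ) (d := k) (Nat.cast_nonneg k) a hs.ne'
  have hinj : Function.Injective (AffineMap.homothety a s) := fun x y hxy => by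
    simpa [AffineMap.homothety_apply, hs.ne'] using hxy
  have hmeas : Measurable (AffineMap.homothety a s) :=
    (AffineMap.homothety_continuous a s).measurable
  have hf : Continuous fun x => f a - f x := by fun_prop
  have key := setIntegral_map (μ := Measure.hausdorffMeasure (k : ℝ)) hA
    (f := fun x => f a - f x) (g := AffineMap.homothety a s)
    hf.measurable.aestronglyMeasurable hmeas.aemeasurable
  rw [hmap, Set.preimage_image_eq _ hinj, Measure.restrict_smul, integral_smul_nnreal_measure,
    NNReal.smul_def] at key
  have hlin : ∀ x, f a - f (AffineMap.homothety a s x) = s * (f a - f x) := fun x => by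
    simp only [AffineMap.homothety_apply, vsub_eq_sub, vadd_eq_add, map_add, map_smul, map_sub,
      smul_eq_mul]
    ring
  simp only [hlin, integral_const_mul] at key
  simp only [NNReal.rpow_natCast, NNReal.coe_pow, NNReal.coe_inv, coe_nnnorm,
    Real.norm_of_nonneg hs.le, smul_eq_mul, inv_pow] at key
  rw [inv_mul_eq_iff_eq_mul₀ (by positivity)] at key
  rw [key]
  ring

open Filter Topology in
/-- If `A` is star-shaped at `a`, then a linear function vanishing at `a` and bounded by `L` on `A`
has average at most `k / (k + 1) * L`. -/
theorem StarConvex.integral_apex_sub_le {E : Type*} [NormedAddCommGroup E] [NormedSpace ℝ E]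
    [MeasurableSpace E] [BorelSpace E] {A : Set E} {a : E} (k : ℕ) (hstar : StarConvex ℝ a A)
    (hcomp : IsCompact A) (hfin : Measure.hausdorffMeasure (k : ℝ) A < ⊤) (f : E →L[ℝ] ℝ) {L : ℝ}
    (hL : ∀ x ∈ A, f a - f x ≤ L) :
    ((k : ℝ) + 1) * ∫ x in A, (f a - f x) ∂(Measure.hausdorffMeasure (k : ℝ)) ≤
      k * (L * (Measure.hausdorffMeasure (k : ℝ)).real A) := by
  set μ : Measure E := Measure.hausdorffMeasure (k : ℝ) with hμ
  set I := ∫ x in A, (f a - f x) ∂μ with hI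
  have hint : IntegrableOn (fun x => f a - f x) A μ := by
    obtain ⟨C, hC⟩ := hcomp.exists_bound_of_continuousOn
      (f := fun x => f a - f x) (by fun_prop)
    refine Measure.integrableOn_of_bounded hfin.ne
      (by fun_prop : Continuous fun x => f a - f x).measurable.aestronglyMeasurable (M := C) ?_
    exact (ae_restrict_iff' hcomp.measurableSet).2 (ae_of_all _ hC)
  have hstep : ∀ s : ℝ, 0 < s → s < 1 →
      (1 - s ^ (k + 1)) * I ≤ (1 - s ^ k) * (L * μ.real A) := by
    intro s hs0 hs1
    have hsub : AffineMap.homothety a s '' A ⊆ A := by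
      rintro _ ⟨x, hx, rfl⟩
      have := hstar hx (a := 1 - s) (b := s) (by linarith) hs0.le (by ring)
      rw [AffineMap.homothety_apply, vsub_eq_sub, vadd_eq_add]
      convert this using 1
      module
    have hmeas : MeasurableSet (AffineMap.homothety a s '' A) :=
      (hcomp.image (AffineMap.homothety_continuous a s)).measurableSet
    have hvol : μ.real (AffineMap.homothety a s '' A) = s ^ k * μ.real A := by
      rw [Measure.real, hμ, hausdorffMeasure_homothety_image (Nat.cast_nonneg k) a hs0.ne',
        NNReal.rpow_natCast, ENNReal.smul_def, smul_eq_mul, ENNReal.toReal_mul]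
      simp [Measure.real, abs_of_pos hs0]
    have hdiff : ∫ x in A \ AffineMap.homothety a s '' A, (f a - f x) ∂μ ≤
        L * μ.real (A \ AffineMap.homothety a s '' A) := by
      have hfin' : μ (A \ AffineMap.homothety a s '' A) ≠ ⊤ :=
        (measure_mono Set.sdiff_subset).trans_lt hfin |>.ne
      calc _ ≤ ∫ x in A \ AffineMap.homothety a s '' A, L ∂μ :=
            setIntegral_mono_on (hint.mono_set Set.sdiff_subset) (integrableOn_const hfin')
              (hcomp.measurableSet.diff hmeas) fun x hx => hL x hx.1
        _ = _ := by rw [setIntegral_const, smul_eq_mul, mul_comm]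
    rw [setIntegral_sdiff hmeas hint hsub, setIntegral_homothety_image k f a hs0 A hmeas,
      measureReal_sdiff hsub hmeas hfin.ne, hvol] at hdiff
    rw [← hμ, ← hI] at hdiff
    linarith
  -- Divide by `1 - s`, which turns both factors into geometric sums, and let `s` tend to `1`.
  have hgeom : ∀ᶠ s : ℝ in 𝓝[<] 1, (∑ i ∈ Finset.range (k + 1), s ^ i) * I ≤
      (∑ i ∈ Finset.range k, s ^ i) * (L * μ.real A) := by
    filter_upwards [Ioo_mem_nhdsLT (zero_lt_one' ℝ)] with s hs
    have h := hstep s hs.1 hs.2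
    rw [← geom_sum_mul_neg, ← geom_sum_mul_neg] at h
    have hpos : 0 < 1 - s := by linarith [hs.2]
    refine le_of_mul_le_mul_right ?_ hpos
    linarith
  have hlim : ∀ (n : ℕ) (c : ℝ),
      Tendsto (fun s : ℝ => (∑ i ∈ Finset.range n, s ^ i) * c) (𝓝[<] 1) (𝓝 (n * c)) := by
    intro n c
    have hc : Continuous fun s : ℝ => (∑ i ∈ Finset.range n, s ^ i) * c := by fun_prop
    simpa using (hc.tendsto 1).mono_left nhdsWithin_le_nhds
  have h := le_of_tendsto_of_tendsto (hlim (k + 1) I) (hlim k (L * μ.real A)) hgeom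
  simpa using h

/-- The average of a linear function over a set star-shaped at `a` is at least its average over a
cone with apex `a` and base on the level `m`. -/
theorem le_setAverage {E : Type*} [NormedAddCommGroup E] [NormedSpace ℝ E]
    [MeasurableSpace E] [BorelSpace E] {A : Set E} {a : E} (k : ℕ) (hstar : StarConvex ℝ a A)
    (hcomp : IsCompact A) (hpos : 0 < Measure.hausdorffMeasure (k : ℝ) A)
    (hfin : Measure.hausdorffMeasure (k : ℝ) A < ⊤) (f : E →L[ℝ] ℝ)
    (hint : IntegrableOn f A (Measure.hausdorffMeasure (k : ℝ))) {m : ℝ} (hm : ∀ x ∈ A, m ≤ f x) :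
    f a + k * m ≤ ((k : ℝ) + 1) * ⨍ x in A, f x ∂(Measure.hausdorffMeasure (k : ℝ)) := by
  have h := hstar.integral_apex_sub_le k hcomp hfin f (L := f a - m)
    fun x hx => by linarith [hm x hx]
  have hμ : 0 < (Measure.hausdorffMeasure (k : ℝ)).real A := ENNReal.toReal_pos hpos.ne' hfin.ne
  have hconst : IntegrableOn (fun _ : E => f a) A (Measure.hausdorffMeasure (k : ℝ)) :=
    integrableOn_const hfin.ne
  rw [integral_sub hconst hint, setIntegral_const, smul_eq_mul] at h
  rw [setAverage_eq, smul_eq_mul, mul_left_comm, ← div_eq_inv_mul, le_div_iff₀ hμ]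
  linarith

/-! ### Centroids of polytopes -/

theorem IsPolytope.convex {d : ℕ} {A : Set (Position d)} (hA : IsPolytope A) : Convex ℝ A := by
  obtain ⟨F, -, rfl⟩ := hA
  exact convex_convexHull ℝ _

theorem IsPolytope.isCompact {d : ℕ} {A : Set (Position d)} (hA : IsPolytope A) :
    IsCompact A := by
  obtain ⟨F, -, rfl⟩ := hA
  exact F.finite_toSet.isCompact_convexHull ℝ

theorem IsPolytope.nonempty {d : ℕ} {A : Set (Position d)} (hA : IsPolytope A) : A.Nonempty := by
  obtain ⟨F, hF, rfl⟩ := hA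
  exact convexHull_nonempty_iff.2 hF

theorem isPolytope_convexHull_range {d : ℕ} {ι : Type*} [Finite ι] [Nonempty ι]
    (y : ι → Position d) : IsPolytope (convexHull ℝ (Set.range y)) :=
  ⟨(Set.finite_range y).toFinset, by simpa using Set.range_nonempty y, by simp⟩

theorem IsPolytope.integrableOn_id {d : ℕ} {A : Set (Position d)} (hA : IsPolytope A) :
    IntegrableOn (fun x => x) A
      (Measure.hausdorffMeasure (Module.finrank ℝ (vectorSpan ℝ A) : ℝ)) := by
  obtain ⟨-, hfin⟩ := hausdorffMeasure_pos_and_lt_top hA.convex hA.isCompact hA.nonempty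
  obtain ⟨C, hC⟩ := hA.isCompact.exists_bound_of_continuousOn
    (f := fun x : Position d => x) (by fun_prop)
  refine Measure.integrableOn_of_bounded hfin.ne measurable_id.aestronglyMeasurable (M := C) ?_
  exact (ae_restrict_iff' hA.isCompact.measurableSet).2 (ae_of_all _ hC)

theorem IsPolytope.centroid_mem {d : ℕ} {A : Set (Position d)} (hA : IsPolytope A) :
    centroid A ∈ A := by
  obtain ⟨hpos, hfin⟩ := hausdorffMeasure_pos_and_lt_top hA.convex hA.isCompact hA.nonempty
  exact hA.convex.set_average_mem hA.isCompact.isClosed hpos.ne' hfin.ne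
    (ae_restrict_mem hA.isCompact.measurableSet) hA.integrableOn_id

/-- If a linear form takes the value `f a` on a polytope and is bounded below by `m`, then its value
at the centroid is at least `m + (f a - m) / (d + 1)`. -/
theorem IsPolytope.le_map_centroid {d : ℕ} {A : Set (Position d)} (hA : IsPolytope A)
    (f : Position d →L[ℝ] ℝ) {a : Position d} (ha : a ∈ A) {m : ℝ} (hm : ∀ x ∈ A, m ≤ f x) :
    1 / ((d : ℝ) + 1) * f a + d / ((d : ℝ) + 1) * m ≤ f (centroid A) := by
  obtain ⟨hpos, hfin⟩ := hausdorffMeasure_pos_and_lt_top hA.convex hA.isCompact hA.nonempty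
  have hint := hA.integrableOn_id
  have h := le_setAverage _ (hA.convex.starConvex ha) hA.isCompact hpos hfin f
    (f.integrable_comp hint) hm
  have hcentroid : ⨍ x in A, f x
      ∂(Measure.hausdorffMeasure (Module.finrank ℝ (vectorSpan ℝ A) : ℝ)) = f (centroid A) := by
    rw [centroid, setAverage_eq, setAverage_eq, map_smul, f.integral_comp_comm hint]
  rw [hcentroid] at h
  -- The centroid is at least `m`, so the bound for the dimension `k` of `A` weakens to that for `d`.
  have hk : (Module.finrank ℝ (vectorSpan ℝ A) : ℝ) ≤ d := by
    have := (vectorSpan ℝ A).finrank_le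
    rw [finrank_euclideanSpace_fin] at this
    exact_mod_cast this
  have hle := mul_le_mul_of_nonneg_right hk (sub_nonneg.2 (hm _ hA.centroid_mem))
  have hd : (0 : ℝ) < d + 1 := by positivity
  rw [div_mul_eq_mul_div, div_mul_eq_mul_div, ← add_div, div_le_iff₀ hd]
  linarith

theorem IsPolytope.map_centroid_le {d : ℕ} {A : Set (Position d)} (hA : IsPolytope A)
    (f : Position d →L[ℝ] ℝ) {a : Position d} (ha : a ∈ A) {M : ℝ} (hM : ∀ x ∈ A, f x ≤ M) :
    f (centroid A) ≤ 1 / ((d : ℝ) + 1) * f a + d / ((d : ℝ) + 1) * M := by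
  have h := hA.le_map_centroid (-f) ha (m := -M) fun x hx => neg_le_neg (hM x hx)
  simp only [neg_apply] at h
  linarith

/-- The coordinate bounds, with the supremum and the infimum attained by compactness. -/
theorem IsPolytope.centroid_coord_bounds {d : ℕ} {A : Set (Position d)} (hA : IsPolytope A)
    (j : Fin d) :
    1 / ((d : ℝ) + 1) * supCoord A j + (d : ℝ) / ((d : ℝ) + 1) * infCoord A j ≤ centroid A j ∧
      centroid A j ≤
        1 / ((d : ℝ) + 1) * infCoord A j + (d : ℝ) / ((d : ℝ) + 1) * supCoord A j := by
  have himage : IsCompact ((fun x : Position d => x j) '' A) := hA.isCompact.image (by fun_prop)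
  obtain ⟨a, ha, hsup⟩ := himage.sSup_mem (hA.nonempty.image _)
  obtain ⟨b, hb, hinf⟩ := himage.sInf_mem (hA.nonempty.image _)
  have hle : ∀ x ∈ A, infCoord A j ≤ x j := fun x hx =>
    csInf_le himage.bddBelow (Set.mem_image_of_mem _ hx)
  have hge : ∀ x ∈ A, x j ≤ supCoord A j := fun x hx =>
    le_csSup himage.bddAbove (Set.mem_image_of_mem _ hx)
  constructor
  · rw [supCoord, ← hsup]
    exact hA.le_map_centroid (EuclideanSpace.proj j) ha hle
  · rw [infCoord, ← hinf]
    exact hA.map_centroid_le (EuclideanSpace.proj j) hb hge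

/-! ### The Centroid algorithm -/

theorem exists_weights_of_mem_convexHull_range {E ι : Type*} [AddCommGroup E] [Module ℝ E]
    [Fintype ι] {y : ι → E} {x : E} (hx : x ∈ convexHull ℝ (Set.range y)) :
    ∃ w : ι → ℝ, (∀ i, 0 ≤ w i) ∧ ∑ i, w i = 1 ∧ x = ∑ i, w i • y i := by
  classical
  have hconv : Convex ℝ (Fintype.linearCombination ℝ y '' stdSimplex ℝ ι) :=
    (convex_stdSimplex ℝ ι).linear_image _
  have hsub : Set.range y ⊆ Fintype.linearCombination ℝ y '' stdSimplex ℝ ι := by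
    rintro _ ⟨i, rfl⟩
    exact ⟨Pi.single i 1, single_mem_stdSimplex ℝ i, by simp⟩
  obtain ⟨w, hw, rfl⟩ := convexHull_min hsub hconv hx
  exact ⟨w, hw.1, hw.2, Fintype.linearCombination_apply ℝ y w⟩

theorem centroidAlgorithm_isConvexCombination (n d : ℕ) :
    (centroidAlgorithm n d).IsConvexCombination := by
  classical
  -- With no message the centroid is a junk value and there are no weights; an in-neighborhood
  -- always contains the agent itself.
  have hweights : ∀ (S : Finset (Fin n)) (y : S → Position d), ∃ w : S → ℝ, S.Nonempty →
      (∀ q, 0 ≤ w q) ∧ ∑ q, w q = 1 ∧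
        centroid (convexHull ℝ (Set.range y)) = ∑ q, w q • y q := by
    intro S y
    by_cases hS : S.Nonempty
    · have := hS.to_subtype
      obtain ⟨w, hw⟩ := exists_weights_of_mem_convexHull_range
        (isPolytope_convexHull_range y).centroid_mem
      exact ⟨w, fun _ => hw⟩
    · exact ⟨0, fun h => absurd h hS⟩
  choose w hw using hweights
  exact ⟨fun _ S y => w S y, fun G x₀ t p => hw _ _ ((G (t + 1)).inNeighbors_nonempty p)⟩

theorem centroidAlgorithm_isSafe (n : ℕ) {d : ℕ} (hd : 1 ≤ d) :
    (centroidAlgorithm n d).IsSafe (1 / ((d : ℝ) + 1)) := by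
  have hd' : (1 : ℝ) ≤ d := by exact_mod_cast hd
  refine ⟨⟨by positivity, one_div_le_one_div_of_le two_pos (by linarith)⟩, ?_⟩
  intro G x₀ t p i m M
  set x := (centroidAlgorithm n d).run G x₀ t
  set S := (G (t + 1)).inNeighbors p
  have hSne : S.Nonempty := (G (t + 1)).inNeighbors_nonempty p
  have := hSne.to_subtype
  set A := convexHull ℝ (Set.range fun q : S => x q)
  have hpoly : IsPolytope A := isPolytope_convexHull_range _
  have hmem : ∀ q ∈ S, x q ∈ A := fun q hq => subset_convexHull ℝ _ ⟨⟨q, hq⟩, rfl⟩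
  have hrun : (centroidAlgorithm n d).run G x₀ (t + 1) p = centroid A := rfl
  let f : Position d →L[ℝ] ℝ := EuclideanSpace.proj i
  have hm : ∀ y ∈ A, m ≤ f y := by
    refine fun y hy => convexHull_min (t := {y | m ≤ f y}) ?_
      (convex_halfSpace_ge f.isLinear m) hy
    rintro _ ⟨q, rfl⟩
    exact Finset.inf'_le (fun q => x q i) q.2
  have hM : ∀ y ∈ A, f y ≤ M := by
    refine fun y hy => convexHull_min (t := {y | f y ≤ M}) ?_
      (convex_halfSpace_le f.isLinear M) hy
    rintro _ ⟨q, rfl⟩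
    exact Finset.le_sup' (fun q => x q i) q.2
  obtain ⟨a, ha, hMa⟩ := S.exists_mem_eq_sup' hSne fun q => x q i
  obtain ⟨b, hb, hmb⟩ := S.exists_mem_eq_inf' hSne fun q => x q i
  have hα : 1 - 1 / ((d : ℝ) + 1) = d / (d + 1) := by field_simp; ring
  rw [hrun, hα]
  constructor
  · have h := hpoly.le_map_centroid f (hmem a ha) hm
    rwa [show f (x a) = M from hMa.symm] at h
  · have h := hpoly.map_centroid_le f (hmem b hb) hM
    rw [show f (x b) = m from hmb.symm] at h
    rw [add_comm]
    exact h

theorem theorem4 (n d : ℕ) (hd : 1 ≤ d) :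
    ((centroidAlgorithm n d).IsConvexCombination ∧
      (centroidAlgorithm n d).IsSafe (1 / ((d : ℝ) + 1))) ∧
    ∀ A : Set (Position d), IsPolytope A →
      centroid A ∈ A ∧
      ∀ j : Fin d,
        1 / ((d : ℝ) + 1) * supCoord A j + (d : ℝ) / ((d : ℝ) + 1) * infCoord A j ≤ centroid A j ∧
        centroid A j ≤
          1 / ((d : ℝ) + 1) * infCoord A j + (d : ℝ) / ((d : ℝ) + 1) * supCoord A j := by
  exact ⟨⟨centroidAlgorithm_isConvexCombination n d, centroidAlgorithm_isSafe n hd⟩,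
    fun A hA => ⟨hA.centroid_mem, hA.centroid_coord_bounds⟩⟩
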